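/- Let $n\in\mathbb{N}$ and $U,C_n,\sigma\in\mathbb{R}$ with $\sigma\ge 0$. For $\theta=(\theta_1,\dots,\theta_n)\in\mathbb{R}^n$ let $y_t=\theta_t+Z_t$, $t=1,\dots,n$, where $Z_1,\dots,Z_n$ are independent $\mathcal{N}(0,\sigma^2)$ random variables (so $Z_t = 0$ if $\sigma=0$). A forecasting strategy $x_{1:n}$ consists of Borel measurable functions $x_t:\mathbb{R}^{t-1}\to\mathbb{R}$, $t=1,\dots,n$; at time $t$ it forecasts $\theta_t$ by $x_t(y_1,\dots,y_{t-1})$. Let $$\mathrm{TV}(C_n)=\Big\{\theta\in\mathbb{R}^n:\ \sum_{t=2}^n|\theta_t-\theta_{t-1}|\le C_n\Big\}.$$ There is a universal constant $c>0$ such that, whenever $\min\{U,C_n\}>2\pi\sigma$ and $n>3$, $$\inf_{x_{1:n}}\ \sup_{\theta\in\mathrm{TV}(C_n),\ |\theta_1|\le U}\ \mathbb{E}\left[\sum_{t=1}^n\big(x_t(y_1,\dots,y_{t-1})-\theta_t\big)^2\right]\ \ge\ c\left(U^2+C_n^2+\sigma^2\log n+n^{1/3}C_n^{2/3}\sigma^{4/3}\right),$$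 where the infimum is over all forecasting strategies. -/

import Mathlib

open MeasureTheory ProbabilityTheory

namespace TVForecast

/-- The discrete difference operator `D θ = (θ₂ - θ₁, …, θₙ - θₙ₋₁)`. The time points `1, …, n`
are indexed by `Fin n`, so that time `1` has index `0`. -/
def diff {n : ℕ} (θ : Fin n → ℝ) (i : Fin (n - 1)) : ℝ :=
  θ ⟨i.val + 1, by omega⟩ - θ ⟨i.val, by omega⟩

/-- The total variation class `TV(C) = {θ ∈ ℝⁿ : ‖D θ‖₁ ≤ C}`. -/
def TV (n : ℕ) (C : ℝ) : Set (Fin n → ℝ) :=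
  {θ | ∑ i, |diff θ i| ≤ C}

/-- The admissible ground truths: sequences in `TV(C)` whose first term satisfies `|θ₁| ≤ U`. -/
def groundTruths (n : ℕ) (U C : ℝ) : Set (Fin n → ℝ) :=
  {θ | θ ∈ TV n C ∧ ∀ h : 0 < n, |θ ⟨0, h⟩| ≤ U}

/-- A forecasting strategy: for each time point, a (Borel measurable) function of the observations
at the strictly earlier time points. -/
structure Strategy (n : ℕ) where
  /-- The forecast as a function of the past observations. -/
  forecast : (t : Fin n) → (Fin t.val → ℝ) → ℝ
  measurable_forecast : ∀ t, Measurable (forecast t)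

/-- The observations strictly before time `t`, namely `y_i = θ_i + z_i` for `i < t`. -/
def past {n : ℕ} (θ z : Fin n → ℝ) (t : Fin n) (i : Fin t.val) : ℝ :=
  θ ⟨i.val, i.isLt.trans t.isLt⟩ + z ⟨i.val, i.isLt.trans t.isLt⟩

/-- The law of the noise `(Z₁, …, Zₙ)`: independent, each Gaussian with mean `0` and
variance `σ²`. -/
noncomputable def noise (n : ℕ) (σ : ℝ) : Measure (Fin n → ℝ) :=
  Measure.pi fun _ => gaussianReal 0 (σ ^ 2).toNNReal

/-- The cumulative squared error `∑ₜ (xₜ(y₁, …, yₜ₋₁) - θₜ)²` for the noise realization `z`. -/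
def cumulativeError {n : ℕ} (x : Strategy n) (θ z : Fin n → ℝ) : ℝ :=
  ∑ t, (x.forecast t (past θ z t) - θ t) ^ 2

/-- The expected cumulative squared error, as an extended nonnegative real (it may be `∞`). -/
noncomputable def risk {n : ℕ} (σ : ℝ) (x : Strategy n) (θ : Fin n → ℝ) : ENNReal :=
  ∫⁻ z, ENNReal.ofReal (cumulativeError x θ z) ∂(noise n σ)

/-- The minimax expected cumulative squared error: infimum over all forecasting strategies of the
supremum over all admissible ground truths. -/
noncomputable def minimaxRisk (n : ℕ) (U C σ : ℝ) : ENNReal :=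
  ⨅ x : Strategy n, ⨆ θ ∈ groundTruths n U C, risk σ x θ

end TVForecast

/-! ### Gaussian change of measure -/

namespace TVForecast

/-! If two truths have pasts before `t` at squared distance at most `4σ²`, the data barely separate
them, so their errors at `t` add up to at least `κ` times the squared gap at `t` (`two_point`).
Averaging over a cube of sign vectors, where each time `t` has its own coordinate to flip, sums
these losses over time (`assouad`).

Four cubes give the four terms. A sign at time 1 gives `U²`, and a jump of random sign at time 2
gives `C²`. Constants with random binary digits at scale `σ` lose about `σ²/t` at time `t`, giving
`σ² log n`. About `a = (nC²/σ²)^(1/3)` blocks with random signs and height of order `C/a` spend the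
variation `C`, hide each sign throughout its block, and lose `n(C/a)² = σ²a` in total. If `a > n`,
the `C²` bound already covers this term. -/

lemma pi_withDensity {ι : Type*} [Fintype ι] {α : ι → Type*} [∀ i, MeasurableSpace (α i)]
    (μ : ∀ i, Measure (α i)) [∀ i, IsProbabilityMeasure (μ i)] (f : ∀ i, α i → ENNReal)
    (hf : ∀ i, Measurable (f i)) [∀ i, SigmaFinite ((μ i).withDensity (f i))] :
    Measure.pi (fun i => (μ i).withDensity (f i))
      = (Measure.pi μ).withDensity (fun x => ∏ i, f i (x i)) := by
  -- On boxes the indicator factorises, and independence of the coordinates splits the integral.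
  refine Measure.pi_eq fun s hs => ?_
  have hm : ∀ i, Measurable ((s i).indicator (f i)) := fun i => (hf i).indicator (hs i)
  rw [withDensity_apply _ (MeasurableSet.univ_pi hs), ← lintegral_indicator (.univ_pi hs)]
  have hprod : ((Set.univ.pi s).indicator fun x : ∀ i, α i => ∏ i, f i (x i))
      = fun x => ∏ i, (s i).indicator (f i) (x i) := by
    ext x
    by_cases hx : x ∈ Set.univ.pi s
    · rw [Set.indicator_of_mem hx]
      exact Finset.prod_congr rfl fun i _ => (Set.indicator_of_mem (hx i trivial) _).symm
    · rw [Set.indicator_of_notMem hx]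
      simp only [Set.mem_univ_pi, not_forall] at hx
      obtain ⟨i, hi⟩ := hx
      exact (Finset.prod_eq_zero (Finset.mem_univ i) (Set.indicator_of_notMem hi _)).symm
  have hind : iIndepFun (fun i (x : ∀ i, α i) => (s i).indicator (f i) (x i)) (Measure.pi μ) :=
    iIndepFun_pi fun i => (hm i).aemeasurable
  rw [hprod, lintegral_prod_eq_prod_lintegral_of_indepFun Finset.univ _ hind
    fun i => (hm i).comp (measurable_pi_apply i)]
  refine Finset.prod_congr rfl fun i _ => ?_
  rw [withDensity_apply _ (hs i), ← lintegral_indicator (hs i)]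
  exact (measurePreserving_eval μ i).lintegral_comp (hm i)

lemma gaussianReal_eq_withDensity (m : ℝ) {v : NNReal} (hv : v ≠ 0) :
    gaussianReal m v = (gaussianReal 0 v).withDensity
      (fun x => ENNReal.ofReal (Real.exp (m * x / v - m ^ 2 / (2 * v)))) := by
  have hv' : (v : ℝ) ≠ 0 := by exact_mod_cast hv
  rw [gaussianReal_of_var_ne_zero _ hv, gaussianReal_of_var_ne_zero _ hv,
    ← withDensity_mul _ (measurable_gaussianPDF 0 v) (by fun_prop)]
  congr 1
  ext x
  rw [Pi.mul_apply, gaussianPDF, gaussianPDF, ← ENNReal.ofReal_mul (gaussianPDFReal_nonneg _ _ _)]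
  congr 1
  rw [gaussianPDFReal, gaussianPDFReal, mul_assoc _ (Real.exp _), ← Real.exp_add]
  congr 2
  field_simp
  ring

/-- The likelihood ratio of the noise shifted by `d` with respect to the noise. -/
noncomputable def likelihoodRatio {n : ℕ} (σ : ℝ) (d z : Fin n → ℝ) : ℝ :=
  ∏ i, Real.exp (d i * z i / σ ^ 2 - d i ^ 2 / (2 * σ ^ 2))

lemma likelihoodRatio_pos {n : ℕ} (σ : ℝ) (d z : Fin n → ℝ) : 0 < likelihoodRatio σ d z :=
  Finset.prod_pos fun _ _ => Real.exp_pos _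

@[fun_prop]
lemma measurable_likelihoodRatio {n : ℕ} (σ : ℝ) (d : Fin n → ℝ) :
    Measurable (likelihoodRatio σ d) := by
  unfold likelihoodRatio
  fun_prop

instance {n : ℕ} (σ : ℝ) : IsProbabilityMeasure (noise n σ) := by
  unfold noise
  infer_instance

lemma noise_map_add {n : ℕ} {σ : ℝ} (hσ : 0 < σ) (d : Fin n → ℝ) :
    (noise n σ).map (fun z => z + d)
      = (noise n σ).withDensity (fun z => ENNReal.ofReal (likelihoodRatio σ d z)) := by
  have hv : (σ ^ 2).toNNReal ≠ 0 := by simpa using hσ.ne'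
  have hc : ((σ ^ 2).toNNReal : ℝ) = σ ^ 2 := Real.coe_toNNReal _ (sq_nonneg σ)
  have h1 : (noise n σ).map (fun z i => z i + d i)
      = Measure.pi fun i => gaussianReal (d i) (σ ^ 2).toNNReal := by
    have hmap (i : Fin n) : (gaussianReal 0 (σ ^ 2).toNNReal).map (fun x => x + d i)
        = gaussianReal (d i) (σ ^ 2).toNNReal := by
      rw [gaussianReal_map_add_const, zero_add]
    have (i : Fin n) :
        SigmaFinite ((gaussianReal 0 (σ ^ 2).toNNReal).map (fun x => x + d i)) := by
      rw [hmap]; infer_instance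
    rw [noise, Measure.pi_map_pi (f := fun i x => x + d i) fun i => by fun_prop]
    simp_rw [hmap]
  have h2 (i : Fin n) := gaussianReal_eq_withDensity (d i) hv
  have (i : Fin n) : SigmaFinite ((gaussianReal 0 (σ ^ 2).toNNReal).withDensity
      (fun x => ENNReal.ofReal (Real.exp (d i * x / (σ ^ 2).toNNReal
        - d i ^ 2 / (2 * (σ ^ 2).toNNReal))))) := by
    rw [← h2]; infer_instance
  calc (noise n σ).map (fun z => z + d)
      = Measure.pi fun i => gaussianReal (d i) (σ ^ 2).toNNReal := h1
    _ = _ := by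
      simp_rw [h2]
      rw [pi_withDensity _ _ fun i => by fun_prop, noise]
      congr 1
      ext z
      rw [likelihoodRatio, ENNReal.ofReal_prod_of_nonneg fun i _ => (Real.exp_pos _).le]
      simp_rw [hc]

lemma lintegral_noise_add {n : ℕ} {σ : ℝ} (hσ : 0 < σ) (d : Fin n → ℝ)
    {F : (Fin n → ℝ) → ENNReal} (hF : Measurable F) :
    ∫⁻ z, F (z + d) ∂(noise n σ)
      = ∫⁻ z, ENNReal.ofReal (likelihoodRatio σ d z) * F z ∂(noise n σ) := by
  rw [← lintegral_map hF (by fun_prop : Measurable fun z : Fin n → ℝ => z + d),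
    noise_map_add hσ, lintegral_withDensity_eq_lintegral_mul _ (by fun_prop) hF]
  rfl

lemma lintegral_likelihoodRatio {n : ℕ} {σ : ℝ} (hσ : 0 < σ) (d : Fin n → ℝ) :
    ∫⁻ z, ENNReal.ofReal (likelihoodRatio σ d z) ∂(noise n σ) = 1 := by
  simpa using (lintegral_noise_add hσ d (F := fun _ => 1) measurable_const).symm

/-- Since a likelihood ratio has mean 1, this makes its second moment explicit. -/
lemma likelihoodRatio_sq {n : ℕ} {σ : ℝ} (hσ : 0 < σ) (d z : Fin n → ℝ) :
    likelihoodRatio σ d z ^ 2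
      = Real.exp ((∑ i, d i ^ 2) / σ ^ 2) * likelihoodRatio σ (2 • d) z := by
  rw [likelihoodRatio, likelihoodRatio, Finset.sum_div, Real.exp_sum, ← Finset.prod_mul_distrib,
    ← Finset.prod_pow]
  refine Finset.prod_congr rfl fun i _ => ?_
  rw [← Real.exp_add, ← Real.exp_nat_mul]
  congr 1
  simp only [Pi.smul_apply, nsmul_eq_mul]
  push_cast
  field_simp
  ring

lemma lintegral_likelihoodRatio_sq {n : ℕ} {σ : ℝ} (hσ : 0 < σ) (d : Fin n → ℝ) :
    ∫⁻ z, ENNReal.ofReal (likelihoodRatio σ d z ^ 2) ∂(noise n σ)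
      = ENNReal.ofReal (Real.exp ((∑ i, d i ^ 2) / σ ^ 2)) := by
  simp_rw [likelihoodRatio_sq hσ, ENNReal.ofReal_mul (Real.exp_pos _).le]
  rw [lintegral_const_mul _ (by fun_prop), lintegral_likelihoodRatio hσ, mul_one]

/-! ### Two-point lower bound -/

/-- The expected squared error of the forecast at time `t`. -/
noncomputable def riskAt {n : ℕ} (σ : ℝ) (x : Strategy n) (θ : Fin n → ℝ) (t : Fin n) : ENNReal :=
  ∫⁻ z, ENNReal.ofReal ((x.forecast t (past θ z t) - θ t) ^ 2) ∂(noise n σ)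

@[fun_prop]
lemma measurable_past {n : ℕ} (θ : Fin n → ℝ) (t : Fin n) :
    Measurable fun z => past θ z t := by
  refine measurable_pi_lambda _ fun i => ?_
  unfold past
  fun_prop

@[fun_prop]
lemma measurable_forecast_past {n : ℕ} (x : Strategy n) (θ : Fin n → ℝ) (t : Fin n) :
    Measurable fun z => x.forecast t (past θ z t) :=
  (x.measurable_forecast t).comp (measurable_past θ t)

lemma risk_eq_sum {n : ℕ} (σ : ℝ) (x : Strategy n) (θ : Fin n → ℝ) :
    risk σ x θ = ∑ t, riskAt σ x θ t := by
  unfold risk riskAt cumulativeError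
  rw [← lintegral_finsetSum _ fun t _ => by fun_prop]
  refine lintegral_congr fun z => ENNReal.ofReal_sum_of_nonneg fun t _ => sq_nonneg _

/-- The constant in the two-point lower bound. -/
noncomputable def κ : ℝ := 1 / (1 + Real.exp 4)

lemma κ_pos : 0 < κ := by unfold κ; positivity

lemma κ_le_half : κ ≤ 1 / 2 := by
  unfold κ
  have : (1 : ℝ) ≤ Real.exp 4 := Real.one_le_exp (by norm_num)
  gcongr
  linarith

/-- The best `f` leaves `(a - b)² l/(1 + l)`; completing a square in `r` bounds this below by a
quadratic in `l`, so only two moments of the likelihood ratio are needed. -/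
lemma two_point_aux (a b f l r : ℝ) (hl : 0 < l) :
    2 * r * (a - b) ^ 2 * l
      ≤ (f - a) ^ 2 + l * (f - b) ^ 2 + r ^ 2 * (a - b) ^ 2 * (l + l ^ 2) := by
  have h : 0 ≤ (1 + l) * ((f - a) ^ 2 + l * (f - b) ^ 2 + r ^ 2 * (a - b) ^ 2 * (l + l ^ 2)
      - 2 * r * (a - b) ^ 2 * l) := by
    have e : (1 + l) * ((f - a) ^ 2 + l * (f - b) ^ 2 + r ^ 2 * (a - b) ^ 2 * (l + l ^ 2)
        - 2 * r * (a - b) ^ 2 * l)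
        = ((f - a) + l * (f - b)) ^ 2 + l * (a - b) ^ 2 * (1 - r * (1 + l)) ^ 2 := by ring
    rw [e]
    positivity
  have := nonneg_of_mul_nonneg_right h (by linarith : 0 < 1 + l)
  linarith

/-- Serves `σ = 0`, where there is no Gaussian density but the distance condition forces equal
pasts. -/
lemma two_point_of_past_eq {n : ℕ} (σ : ℝ) (x : Strategy n) (θ θ' : Fin n → ℝ) (t : Fin n)
    (h : ∀ i < t, θ i = θ' i) :
    ENNReal.ofReal (κ * (θ t - θ' t) ^ 2) ≤ riskAt σ x θ t + riskAt σ x θ' t := by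
  have hp (z : Fin n → ℝ) : past θ' z t = past θ z t := by
    ext i
    simp only [past]
    rw [h ⟨i, i.isLt.trans t.isLt⟩ i.isLt]
  unfold riskAt
  simp_rw [hp]
  rw [← lintegral_add_left (by fun_prop)]
  calc ENNReal.ofReal (κ * (θ t - θ' t) ^ 2)
      = ∫⁻ _, ENNReal.ofReal (κ * (θ t - θ' t) ^ 2) ∂(noise n σ) := by simp
    _ ≤ _ := by
      refine lintegral_mono fun z => ?_
      rw [← ENNReal.ofReal_add (sq_nonneg _) (sq_nonneg _)]
      refine ENNReal.ofReal_le_ofReal ?_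
      set f := x.forecast t (past θ z t)
      nlinarith [κ_le_half, sq_nonneg (θ t - θ' t), sq_nonneg ((f - θ t) + (f - θ' t))]

lemma two_point_of_pos {n : ℕ} {σ : ℝ} (hσ : 0 < σ) (x : Strategy n) (θ θ' : Fin n → ℝ)
    (t : Fin n) (h : ∑ i with i < t, (θ' i - θ i) ^ 2 ≤ 4 * σ ^ 2) :
    ENNReal.ofReal (κ * (θ t - θ' t) ^ 2) ≤ riskAt σ x θ t + riskAt σ x θ' t := by
  -- The shift is cut off at `t` because the forecast sees nothing later.
  set d : Fin n → ℝ := fun i => if i < t then θ' i - θ i else 0 with hd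
  have hds : ∑ i, d i ^ 2 ≤ 4 * σ ^ 2 := by
    refine le_trans (le_of_eq ?_) h
    rw [Finset.sum_filter]
    refine Finset.sum_congr rfl fun i _ => ?_
    simp only [hd]
    split_ifs <;> simp
  have hp (z : Fin n → ℝ) : past θ' z t = past θ (z + d) t := by
    ext i
    have hi : (⟨i, i.isLt.trans t.isLt⟩ : Fin n) < t := i.isLt
    simp only [past, Pi.add_apply, hd, if_pos hi]
    ring
  set L := likelihoodRatio σ d
  have h2 : riskAt σ x θ' t
      = ∫⁻ z, ENNReal.ofReal (L z) * ENNReal.ofReal ((x.forecast t (past θ z t) - θ' t) ^ 2)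
          ∂(noise n σ) := by
    unfold riskAt
    simp_rw [hp]
    exact lintegral_noise_add hσ d
      (F := fun z => ENNReal.ofReal ((x.forecast t (past θ z t) - θ' t) ^ 2)) (by fun_prop)
  set g := (θ t - θ' t) ^ 2 with hg
  have hg0 : 0 ≤ g := sq_nonneg _
  have hκ := κ_pos
  have hLm : Measurable L := measurable_likelihoodRatio σ d
  have hL1 : ∫⁻ z, ENNReal.ofReal (L z) ∂(noise n σ) = 1 := lintegral_likelihoodRatio hσ d
  have hL2 : ∫⁻ z, ENNReal.ofReal (L z ^ 2) ∂(noise n σ) ≤ ENNReal.ofReal (Real.exp 4) := by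
    rw [lintegral_likelihoodRatio_sq hσ]
    refine ENNReal.ofReal_le_ofReal (Real.exp_le_exp.2 ?_)
    rwa [div_le_iff₀ (by positivity)]
  have hmain : ENNReal.ofReal (2 * κ * g)
      ≤ riskAt σ x θ t + riskAt σ x θ' t + ENNReal.ofReal (κ * g) :=
    calc ENNReal.ofReal (2 * κ * g)
        = ∫⁻ z, ENNReal.ofReal (2 * κ * g * L z) ∂(noise n σ) := by
          simp_rw [ENNReal.ofReal_mul (by positivity : 0 ≤ 2 * κ * g)]
          rw [lintegral_const_mul _ (by fun_prop), hL1, mul_one]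
      _ ≤ ∫⁻ z, (ENNReal.ofReal ((x.forecast t (past θ z t) - θ t) ^ 2)
            + ENNReal.ofReal (L z) * ENNReal.ofReal ((x.forecast t (past θ z t) - θ' t) ^ 2)
            + ENNReal.ofReal (κ ^ 2 * g) * (ENNReal.ofReal (L z) + ENNReal.ofReal (L z ^ 2)))
            ∂(noise n σ) := by
          refine lintegral_mono fun z => ?_
          have hl : 0 < L z := likelihoodRatio_pos σ d z
          rw [← ENNReal.ofReal_mul hl.le, ← ENNReal.ofReal_add hl.le (by positivity),
            ← ENNReal.ofReal_mul (by positivity), ← ENNReal.ofReal_add (by positivity)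
            (by positivity), ← ENNReal.ofReal_add (by positivity) (by positivity)]
          exact ENNReal.ofReal_le_ofReal (two_point_aux _ _ _ _ _ hl)
      _ = riskAt σ x θ t + riskAt σ x θ' t + ENNReal.ofReal (κ ^ 2 * g)
            * (1 + ∫⁻ z, ENNReal.ofReal (L z ^ 2) ∂(noise n σ)) := by
          rw [lintegral_add_left (by fun_prop), lintegral_add_left (by fun_prop),
            lintegral_const_mul _ (by fun_prop), lintegral_add_left (by fun_prop), hL1, h2]
          rfl
      -- `κ` is chosen so that `κ²(1 + e⁴) = κ`.
      _ ≤ riskAt σ x θ t + riskAt σ x θ' t + ENNReal.ofReal (κ * g) := by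
          gcongr
          calc ENNReal.ofReal (κ ^ 2 * g) * (1 + ∫⁻ z, ENNReal.ofReal (L z ^ 2) ∂(noise n σ))
              ≤ ENNReal.ofReal (κ ^ 2 * g) * (1 + ENNReal.ofReal (Real.exp 4)) := by gcongr
            _ = ENNReal.ofReal (κ * g) := by
              rw [← ENNReal.ofReal_one, ← ENNReal.ofReal_add zero_le_one (Real.exp_pos _).le,
                ← ENNReal.ofReal_mul (by positivity)]
              congr 1
              unfold κ
              field_simp
  rw [mul_assoc, two_mul, ENNReal.ofReal_add (by positivity) (by positivity)] at hmain
  exact (ENNReal.add_le_add_iff_right ENNReal.ofReal_ne_top).1 hmain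

lemma two_point {n : ℕ} {σ : ℝ} (hσ : 0 ≤ σ) (x : Strategy n) (θ θ' : Fin n → ℝ) (t : Fin n)
    (h : ∑ i with i < t, (θ' i - θ i) ^ 2 ≤ 4 * σ ^ 2) :
    ENNReal.ofReal (κ * (θ t - θ' t) ^ 2) ≤ riskAt σ x θ t + riskAt σ x θ' t := by
  rcases hσ.eq_or_lt with rfl | hσ
  · refine two_point_of_past_eq _ x θ θ' t fun i hi => ?_
    have h0 : (θ' i - θ i) ^ 2 ≤ 0 :=
      (Finset.single_le_sum (f := fun i => (θ' i - θ i) ^ 2) (fun _ _ => sq_nonneg _)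
        (Finset.mem_filter.2 ⟨Finset.mem_univ i, hi⟩)).trans (by simpa using h)
    have := pow_eq_zero_iff two_ne_zero |>.1 (h0.antisymm (sq_nonneg _))
    linarith
  · exact two_point_of_pos hσ x θ θ' t h

/-! ### Assouad's lemma -/

/-- The sign vector `ε` with the sign at `j` reversed. -/
def flip {K : ℕ} (j : Fin K) (ε : Fin K → Bool) : Fin K → Bool := Function.update ε j (!ε j)

lemma flip_involutive {K : ℕ} (j : Fin K) : Function.Involutive (flip j) := by
  intro ε
  simp [flip]

/-- Assouad's lemma: the forecast at a time `t ∈ T` cannot tell `Θ ε` from the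
sequence with the sign at `b t` reversed. -/
lemma assouad {n K : ℕ} {σ : ℝ} (hσ : 0 ≤ σ) (x : Strategy n) (Θ : (Fin K → Bool) → Fin n → ℝ)
    (T : Finset (Fin n)) (b : Fin n → Fin K) (g : Fin n → ℝ)
    (hg : ∀ t ∈ T, ∀ ε, g t ≤ (Θ ε t - Θ (flip (b t) ε) t) ^ 2)
    (hpast : ∀ t ∈ T, ∀ ε, ∑ i with i < t, (Θ (flip (b t) ε) i - Θ ε i) ^ 2 ≤ 4 * σ ^ 2)
    (S : ENNReal) (hS : ∀ ε, risk σ x (Θ ε) ≤ S) :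
    ENNReal.ofReal (κ / 2 * ∑ t ∈ T, g t) ≤ S := by
  have hT (t : Fin n) (ht : t ∈ T) :
      ∑ _ε : Fin K → Bool, ENNReal.ofReal (κ * g t) ≤ 2 * ∑ ε, riskAt σ x (Θ ε) t := by
    -- Flipping permutes the cube, so both members of each pair contribute the same total.
    have hflip : ∑ ε, riskAt σ x (Θ (flip (b t) ε)) t = ∑ ε, riskAt σ x (Θ ε) t :=
      (flip_involutive (b t)).bijective.sum_comp fun ε => riskAt σ x (Θ ε) t
    rw [two_mul]
    nth_rewrite 2 [← hflip]
    rw [← Finset.sum_add_distrib]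
    refine Finset.sum_le_sum fun ε _ => ?_
    refine le_trans (ENNReal.ofReal_le_ofReal ?_) (two_point hσ x _ _ t (hpast t ht ε))
    exact mul_le_mul_of_nonneg_left (hg t ht ε) κ_pos.le
  set N : ENNReal := (Fintype.card (Fin K → Bool) : ENNReal) with hN
  have hN0 : N ≠ 0 := by simp [hN]
  have hNt : N ≠ ⊤ := ENNReal.natCast_ne_top _
  have key : N * ENNReal.ofReal (κ * ∑ t ∈ T, g t) ≤ N * (2 * S) :=
    calc N * ENNReal.ofReal (κ * ∑ t ∈ T, g t)
        ≤ N * ∑ t ∈ T, ENNReal.ofReal (κ * g t) := by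
          rw [Finset.mul_sum]
          refine mul_le_mul_right ?_ _
          exact Finset.le_sum_of_subadditive _ ENNReal.ofReal_zero.le (fun _ _ => ENNReal.ofReal_add_le) _ _
      _ = ∑ t ∈ T, ∑ _ε : Fin K → Bool, ENNReal.ofReal (κ * g t) := by
          simp_rw [Finset.sum_const, nsmul_eq_mul, Finset.mul_sum]
          rfl
      _ ≤ ∑ t ∈ T, 2 * ∑ ε, riskAt σ x (Θ ε) t := Finset.sum_le_sum hT
      _ = 2 * ∑ ε, ∑ t ∈ T, riskAt σ x (Θ ε) t := by
          rw [← Finset.mul_sum, Finset.sum_comm]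
      _ ≤ 2 * ∑ _ε : Fin K → Bool, S := by
          gcongr with ε
          refine le_trans ?_ (hS ε)
          rw [risk_eq_sum]
          exact Finset.sum_le_sum_of_subset (Finset.subset_univ T)
      _ = N * (2 * S) := by
          rw [Finset.sum_const, nsmul_eq_mul, Finset.card_univ, ← mul_assoc, ← mul_assoc,
            mul_comm 2]
  have h2 := (ENNReal.mul_le_mul_iff_right hN0 hNt).1 key
  rw [div_mul_eq_mul_div, ENNReal.ofReal_div_of_pos two_pos, ENNReal.ofReal_ofNat]
  exact ENNReal.div_le_of_le_mul (by rwa [mul_comm S])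

/-- The real sign encoded by a Boolean. -/
def sign (s : Bool) : ℝ := if s then 1 else -1

lemma abs_sign (s : Bool) : |sign s| = 1 := by cases s <;> simp [sign]

lemma sign_not (s : Bool) : sign (!s) = -sign s := by cases s <;> simp [sign]

lemma sign_sq (s : Bool) : sign s ^ 2 = 1 := by cases s <;> simp [sign]

lemma sign_flip_self {K : ℕ} (j : Fin K) (ε : Fin K → Bool) :
    sign (flip j ε j) = -sign (ε j) := by simp [flip, sign_not]

lemma sign_flip_of_ne {K : ℕ} {j k : Fin K} (h : k ≠ j) (ε : Fin K → Bool) :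
    sign (flip j ε k) = sign (ε k) := by simp [flip, h]

/-- The sequence moves only when the integer label `b` increases, and each such move costs at most
`δ` times the increase. -/
lemma mem_TV_of_step {n : ℕ} {θ : Fin n → ℝ} {b : ℕ → ℕ} (hb : Monotone b) (h : ℕ → ℝ) {δ C : ℝ}
    (hθ : ∀ t : Fin n, θ t = h (b t)) (hδ : ∀ k l, |h k - h l| ≤ δ)
    (hC : δ * b (n - 1) ≤ C) : θ ∈ TV n C := by
  have hδ0 : 0 ≤ δ := (abs_nonneg _).trans (hδ 0 0)
  have hstep (i : Fin (n - 1)) : |diff θ i| ≤ δ * (b (i.val + 1) - b i.val) := by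
    unfold diff
    rw [hθ, hθ]
    rcases (hb (Nat.le_succ i.val)).eq_or_lt with he | hl
    · simp only [Nat.succ_eq_add_one] at he
      simp [he]
    · have : (b i.val : ℝ) + 1 ≤ b (i.val + 1) := by exact_mod_cast hl
      calc _ ≤ δ * 1 := by rw [mul_one]; exact hδ _ _
        _ ≤ _ := by gcongr; linarith
  calc ∑ i, |diff θ i| ≤ ∑ i : Fin (n - 1), δ * ((b (i.val + 1) : ℝ) - b i.val) :=
        Finset.sum_le_sum fun i _ => hstep i
    _ = δ * (b (n - 1) - b 0) := by
        rw [← Finset.mul_sum, Fin.sum_univ_eq_sum_range fun i => (b (i + 1) : ℝ) - b i,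
          Finset.sum_range_sub fun i => (b i : ℝ)]
    _ ≤ δ * b (n - 1) := by
        gcongr
        exact sub_le_self _ (Nat.cast_nonneg _)
    _ ≤ C := hC

/-! ### Unpredictable start and jump -/

lemma lower_bound_U {n : ℕ} {U C σ : ℝ} (hn : 3 < n) (hσ : 0 ≤ σ) (hU : 0 ≤ U) (hC : 0 ≤ C)
    (x : Strategy n) (S : ENNReal) (hS : ∀ θ ∈ groundTruths n U C, risk σ x θ ≤ S) :
    ENNReal.ofReal (2 * κ * U ^ 2) ≤ S := by
  let Θ : (Fin 1 → Bool) → Fin n → ℝ := fun ε _ => U * sign (ε 0)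
  let t₀ : Fin n := ⟨0, by omega⟩
  have := assouad hσ x Θ {t₀} (fun _ => 0) (fun _ => 4 * U ^ 2)
    (fun t _ ε => by
      simp only [Θ, sign_flip_self]
      nlinarith [sign_sq (ε 0)])
    (fun t ht ε => by
      rw [Finset.mem_singleton.1 ht, Finset.filter_false_of_mem]
      · simp; positivity
      · intro i _; exact not_lt.2 (Nat.zero_le i.val)) S
    (fun ε => hS _ ⟨mem_TV_of_step (b := fun _ => 0) (δ := 0) monotone_const
      (fun _ => U * sign (ε 0)) (fun _ => rfl) (by simp) (by simpa using hC), fun _ => by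
        simp only [Θ, abs_mul, abs_sign, mul_one, abs_of_nonneg hU, le_refl]⟩)
  refine le_trans (le_of_eq ?_) this
  rw [Finset.sum_singleton]
  ring_nf

lemma lower_bound_C {n : ℕ} {U C σ : ℝ} (hn : 3 < n) (hσ : 0 ≤ σ) (hU : 0 ≤ U) (hC : 0 ≤ C)
    (x : Strategy n) (S : ENNReal) (hS : ∀ θ ∈ groundTruths n U C, risk σ x θ ≤ S) :
    ENNReal.ofReal (2 * κ * C ^ 2) ≤ S := by
  let h : (Fin 1 → Bool) → ℕ → ℝ := fun ε k => if k = 0 then 0 else C * sign (ε 0)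
  let Θ : (Fin 1 → Bool) → Fin n → ℝ := fun ε t => h ε (min t 1)
  let t₁ : Fin n := ⟨1, by omega⟩
  have habs (ε : Fin 1 → Bool) : |C * sign (ε 0)| ≤ C := by
    rw [abs_mul, abs_sign, mul_one, abs_of_nonneg hC]
  have := assouad hσ x Θ {t₁} (fun _ => 0) (fun _ => 4 * C ^ 2)
    (fun t ht ε => by
      rw [Finset.mem_singleton.1 ht]
      simp only [Θ, h, t₁, min_self, one_ne_zero, if_false, sign_flip_self]
      nlinarith [sign_sq (ε 0)])
    (fun t ht ε => by
      rw [Finset.mem_singleton.1 ht, Finset.sum_eq_zero]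
      · positivity
      · intro i hi
        have hi0 : i.val = 0 := by
          have : i.val < 1 := (Finset.mem_filter.1 hi).2
          omega
        simp [Θ, h, hi0]) S
    (fun ε => hS _ ⟨mem_TV_of_step (b := fun t => min t 1) (δ := C)
      (fun _ _ hab => min_le_min_right 1 hab) (h ε) (fun _ => rfl)
      (fun k l => by
        simp only [h]
        split_ifs
        · simpa using hC
        · simpa using habs ε
        · simpa using habs ε
        · simpa using hC)
      (by
        have : min (n - 1) 1 = 1 := by omega
        simp [this]), fun _ => by simpa [Θ, h] using hU⟩)
  refine le_trans (le_of_eq ?_) this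
  rw [Finset.sum_singleton]
  ring_nf

/-! ### Logarithmic term: random binary digits -/

lemma sum_half_pow_le (K : ℕ) : ∑ k : Fin K, (1 / 2 : ℝ) ^ (k.val + 1) ≤ 1 := by
  rw [Fin.sum_univ_eq_sum_range fun k => (1 / 2 : ℝ) ^ (k + 1)]
  simp_rw [pow_succ]
  rw [← Finset.sum_mul]
  linarith [sum_geometric_two_le K]

lemma lower_bound_log {n : ℕ} {U C σ : ℝ} (hn : 3 < n) (hσ : 0 ≤ σ) (hU : σ ≤ U) (hC : 0 ≤ C)
    (x : Strategy n) (S : ENNReal) (hS : ∀ θ ∈ groundTruths n U C, risk σ x θ ≤ S) :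
    ENNReal.ofReal (κ / 4 * (σ ^ 2 * Real.log n)) ≤ S := by
  set K := Nat.log 4 n with hK
  have hK1 : 1 ≤ K := Nat.log_pos (by norm_num) (by omega)
  have hKn : 4 ^ K ≤ n := Nat.pow_log_le_self 4 (by omega)
  have hnK : n < 4 ^ (K + 1) := Nat.lt_pow_succ_log_self (by norm_num) n
  let v : (Fin K → Bool) → ℝ := fun ε => σ * ∑ k, sign (ε k) * (1 / 2 : ℝ) ^ (k.val + 1)
  let Θ : (Fin K → Bool) → Fin n → ℝ := fun ε _ => v ε
  have hv (ε : Fin K → Bool) (j : Fin K) :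
      (v ε - v (flip j ε)) ^ 2 = σ ^ 2 * (1 / 4 : ℝ) ^ j.val := by
    have : v ε - v (flip j ε) = σ * (sign (ε j) * (1 / 2 : ℝ) ^ j.val) := by
      simp only [v]
      rw [← mul_sub, ← Finset.sum_sub_distrib, Finset.sum_eq_single j]
      · rw [sign_flip_self]; ring
      · intro k _ hk
        rw [sign_flip_of_ne hk, sub_self]
      · simp
    rw [this, mul_pow, mul_pow, sign_sq, one_mul, ← pow_mul, mul_comm j.val, pow_mul]
    norm_num
  -- Flipping digit `k` moves the constant by `σ/2^k`, which fewer than `4^(k+1)` observations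
  -- cannot detect. The cap only matters outside `T`.
  let b : Fin n → Fin K := fun t => ⟨min (Nat.log 4 t) (K - 1), by omega⟩
  let T : Finset (Fin n) := Finset.univ.filter fun t => t.val < 4 ^ K
  have hb (t : Fin n) (ht : t ∈ T) : t.val < 4 ^ ((b t).val + 1) := by
    have h1 : t.val < 4 ^ K := (Finset.mem_filter.1 ht).2
    simp only [b]
    rcases le_total (Nat.log 4 t) (K - 1) with h | h
    · rw [min_eq_left h]; exact Nat.lt_pow_succ_log_self (by norm_num) _
    · rw [min_eq_right h, Nat.sub_add_cancel hK1]; exact h1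
  have hb' (t : Fin n) : (4 : ℝ) ^ (b t).val ≤ t.val + 1 := by
    have h1 : 4 ^ (b t).val ≤ 4 ^ Nat.log 4 t :=
      Nat.pow_le_pow_right (by norm_num) (min_le_left _ _)
    have h2 : 4 ^ Nat.log 4 t.val ≤ t.val + 1 := by
      rcases Nat.eq_zero_or_pos t.val with h | h
      · simp [h]
      · exact (Nat.pow_log_le_self 4 h.ne').trans (Nat.le_succ _)
    exact_mod_cast h1.trans h2
  have main := assouad hσ x Θ T b (fun t => σ ^ 2 * ((t.val : ℝ) + 1)⁻¹)
    (fun t _ ε => by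
      simp only [Θ]
      rw [hv]
      gcongr
      rw [one_div, inv_pow]
      gcongr
      exact hb' t)
    (fun t ht ε => by
      have hc : (Finset.univ.filter fun i : Fin n => i < t).card = t.val := by
        rw [Finset.filter_gt_eq_Iio, Fin.card_Iio]
      simp only [Θ]
      rw [Finset.sum_const, hc, nsmul_eq_mul, ← neg_sub, neg_sq, hv]
      have h4 : (t.val : ℝ) ≤ 4 ^ ((b t).val + 1) := by exact_mod_cast (hb t ht).le
      calc (t.val : ℝ) * (σ ^ 2 * (1 / 4 : ℝ) ^ (b t).val)
          ≤ 4 ^ ((b t).val + 1) * (σ ^ 2 * (1 / 4 : ℝ) ^ (b t).val) := by gcongr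
        _ = 4 * σ ^ 2 * (4 * (1 / 4 : ℝ)) ^ (b t).val := by rw [mul_pow, pow_succ]; ring
        _ = 4 * σ ^ 2 := by norm_num) S
    (fun ε => hS _ ⟨mem_TV_of_step (b := fun _ => 0) (δ := 0) monotone_const
      (fun _ => v ε) (fun _ => rfl) (by simp) (by simpa using hC), fun _ => by
        refine le_trans ?_ hU
        simp only [Θ, v]
        rw [abs_mul, abs_of_nonneg hσ]
        refine mul_le_of_le_one_right hσ ((Finset.abs_sum_le_sum_abs _ _).trans ?_)
        simp_rw [abs_mul, abs_sign, one_mul]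
        rw [Finset.sum_congr rfl fun k _ => abs_of_nonneg (by positivity)]
        exact sum_half_pow_le K⟩)
  refine le_trans (ENNReal.ofReal_le_ofReal ?_) main
  have hsum : ∑ t ∈ T, ((t.val : ℝ) + 1)⁻¹ = ∑ t ∈ Finset.range (4 ^ K), ((t : ℝ) + 1)⁻¹ := by
    rw [Finset.sum_filter,
      Fin.sum_univ_eq_sum_range fun t => if t < 4 ^ K then ((t : ℝ) + 1)⁻¹ else 0,
      ← Finset.sum_filter]
    congr 1
    ext t
    simp only [Finset.mem_filter, Finset.mem_range]
    omega
  have hharm : Real.log (4 ^ K : ℕ) ≤ ∑ t ∈ Finset.range (4 ^ K), ((t : ℝ) + 1)⁻¹ := by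
    have h1 := log_add_one_le_harmonic (4 ^ K)
    have h2 : ((harmonic (4 ^ K) : ℚ) : ℝ) = ∑ t ∈ Finset.range (4 ^ K), ((t : ℝ) + 1)⁻¹ := by
      simp [harmonic]
    rw [← h2]
    refine le_trans (Real.log_le_log (by positivity) ?_) h1
    push_cast
    linarith
  -- Since `K ≥ 1`, `n < 4^(K+1) ≤ (4^K)²`.
  have hlog : Real.log n ≤ 2 * Real.log (4 ^ K : ℕ) := by
    have h1 : (n : ℝ) ≤ 4 ^ (K + 1) := by exact_mod_cast hnK.le
    have h2 : (1 : ℝ) ≤ K := by exact_mod_cast hK1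
    have h3 : 0 < Real.log 4 := Real.log_pos (by norm_num)
    have h4 := Real.log_le_log (by positivity) h1
    rw [Real.log_pow] at h4
    push_cast at h4 ⊢
    rw [Real.log_pow]
    nlinarith
  rw [← Finset.mul_sum, hsum]
  have := mul_le_mul_of_nonneg_left (hlog.trans (mul_le_mul_of_nonneg_left hharm zero_le_two))
    (mul_nonneg κ_pos.le (sq_nonneg σ))
  linarith

/-! ### Cube-root term: random block signs -/

/-- When `n` time points are split into `K` blocks, at most `n / K` of them precede `t` in the
block of `t`. -/
lemma card_block_mul_le {n K : ℕ} (hK : 0 < K) (t : Fin n) :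
    (Finset.univ.filter fun i : Fin n => i < t ∧ i.val * K / n = t.val * K / n).card * K ≤ n := by
  have hn : 0 < n := t.pos
  have hle : (Finset.univ.filter fun i : Fin n =>
      i < t ∧ i.val * K / n = t.val * K / n).card ≤ (Finset.Icc 1 (n / K)).card := by
    -- Indices in one block satisfy `(t - i)K < n`, so the lags lie in `{1, …, n / K}`.
    refine Finset.card_le_card_of_injOn (fun i => t.val - i.val) ?_ ?_
    · intro i hi
      obtain ⟨hit, hb⟩ := (Finset.mem_filter.1 hi).2
      have hit' : i.val < t.val := hit
      refine Finset.mem_coe.2 (Finset.mem_Icc.2 ⟨Nat.sub_pos_of_lt hit', (Nat.le_div_iff_mul_le hK).2 ?_⟩)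
      have h1 := Nat.div_mul_le_self (i.val * K) n
      have h2 := Nat.lt_div_mul_add hn (a := t.val * K)
      rw [hb] at h1
      simp only [Nat.sub_mul]
      omega
    · intro i hi j hj hij
      have h1 : i.val < t.val := (Finset.mem_filter.1 hi).2.1
      have h2 : j.val < t.val := (Finset.mem_filter.1 hj).2.1
      simp only at hij
      exact Fin.ext (by omega)
  rw [Nat.card_Icc, Nat.add_sub_cancel] at hle
  exact (Nat.mul_le_mul_right K hle).trans (Nat.div_mul_le_self n K)

lemma lower_bound_blocks {n : ℕ} {U C σ a : ℝ} (hσ : 0 ≤ σ) (hU : σ ≤ U) (hC : 0 ≤ C)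
    (ha1 : 1 ≤ a) (han : a ≤ n) (ha : a ^ 3 * σ ^ 2 = n * C ^ 2)
    (x : Strategy n) (S : ENNReal) (hS : ∀ θ ∈ groundTruths n U C, risk σ x θ ≤ S) :
    ENNReal.ofReal (κ / 2 * (σ ^ 2 * a)) ≤ S := by
  have ha0 : 0 < a := by linarith
  have hnR : (0 : ℝ) < n := by linarith
  have hn : 0 < n := by exact_mod_cast hnR
  set K := ⌊a⌋₊
  have hK : 0 < K := Nat.floor_pos.2 ha1
  have hKa : (K : ℝ) ≤ a := Nat.floor_le ha0.le
  have hK2 : a ≤ 2 * K := by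
    have h1 : a < K + 1 := Nat.lt_floor_add_one a
    have h2 : (1 : ℝ) ≤ K := by exact_mod_cast hK
    linarith
  set w := C / a with hw
  have hw0 : 0 ≤ w := by positivity
  have hwσ : n * w ^ 2 = σ ^ 2 * a := by
    rw [hw, div_pow]
    field_simp
    linarith
  -- This, through `a ≤ n`, keeps the first term within `U`.
  have hwle : w ≤ σ := by
    refine (pow_le_pow_iff_left₀ hw0 hσ two_ne_zero).1 ?_
    have : n * w ^ 2 ≤ n * σ ^ 2 := by
      rw [hwσ, mul_comm]
      gcongr
    exact le_of_mul_le_mul_left this hnR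
  have hblt (t : ℕ) (ht : t < n) : t * K / n < K := by
    rw [Nat.div_lt_iff_lt_mul hn, mul_comm K]
    exact Nat.mul_lt_mul_of_pos_right ht hK
  let b : Fin n → Fin K := fun t => ⟨t.val * K / n, hblt t t.isLt⟩
  -- The default 0 is never reached by a block label.
  let h : (Fin K → Bool) → ℕ → ℝ := fun ε k => if hk : k < K then w / 2 * sign (ε ⟨k, hk⟩) else 0
  let Θ : (Fin K → Bool) → Fin n → ℝ := fun ε t => w / 2 * sign (ε (b t))
  have hh (ε : Fin K → Bool) (k : ℕ) : |h ε k| ≤ w / 2 := by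
    simp only [h]
    split_ifs
    · rw [abs_mul, abs_sign, mul_one, abs_of_nonneg (by positivity)]
    · rw [abs_zero]; positivity
  have hdiff (ε : Fin K → Bool) (j : Fin K) (t : Fin n) :
      (Θ (flip j ε) t - Θ ε t) ^ 2 = if b t = j then w ^ 2 else 0 := by
    simp only [Θ]
    split_ifs with hj
    · rw [hj, sign_flip_self]
      linear_combination w ^ 2 * sign_sq (ε j)
    · rw [sign_flip_of_ne hj]; ring
  have main := assouad hσ x Θ Finset.univ b (fun _ => w ^ 2)
    (fun t _ ε => by rw [← neg_sub, neg_sq, hdiff, if_pos rfl])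
    (fun t _ ε => by
      simp_rw [hdiff]
      rw [← Finset.sum_filter, Finset.filter_filter, Finset.sum_const, nsmul_eq_mul]
      have hcard := card_block_mul_le hK t
      simp only [b, Fin.mk.injEq]
      set N := (Finset.univ.filter fun i : Fin n =>
        i < t ∧ i.val * K / n = t.val * K / n).card
      have hN : (N : ℝ) * K ≤ n := by exact_mod_cast hcard
      have hNa : N * a ≤ 2 * n := by nlinarith [(Nat.cast_nonneg N : (0 : ℝ) ≤ N)]
      have h1 : a * (N * w ^ 2) ≤ a * (2 * σ ^ 2) := by
        calc a * (N * w ^ 2) = N * a * w ^ 2 := by ring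
          _ ≤ 2 * n * w ^ 2 := by gcongr
          _ = a * (2 * σ ^ 2) := by rw [mul_assoc, hwσ]; ring
      have h2 := le_of_mul_le_mul_left h1 ha0
      nlinarith [sq_nonneg σ]) S
    (fun ε => hS _ ⟨mem_TV_of_step (b := fun t => t * K / n) (δ := w)
      (fun s t hst => Nat.div_le_div_right (Nat.mul_le_mul_right K hst)) (h ε)
      (fun t => by simp only [Θ, h, b, hblt t t.isLt, dif_pos])
      (fun k l => by
        have := abs_sub (h ε k) (h ε l)
        linarith [hh ε k, hh ε l])
      (by
        have h1 : (((n - 1) * K / n : ℕ) : ℝ) ≤ a :=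
          le_trans (by exact_mod_cast (hblt (n - 1) (by omega)).le) hKa
        calc w * (((n - 1) * K / n : ℕ) : ℝ) ≤ w * a := by gcongr
          _ = C := div_mul_cancel₀ C ha0.ne'), fun h0 => by
        simp only [Θ]
        rw [abs_mul, abs_sign, mul_one, abs_of_nonneg (by positivity)]
        linarith⟩)
  rwa [Finset.sum_const, Finset.card_univ, Fintype.card_fin, nsmul_eq_mul, hwσ] at main

lemma rpow_third_mul_identity {n C σ : ℝ} (hn : 0 < n) (hC : 0 < C) (hσ : 0 < σ) :
    n ^ (1 / 3 : ℝ) * C ^ (2 / 3 : ℝ) * σ ^ (4 / 3 : ℝ)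
      = σ ^ 2 * (n * (C / σ) ^ 2) ^ (1 / 3 : ℝ) := by
  rw [Real.mul_rpow hn.le (by positivity), ← Real.rpow_natCast (C / σ) 2,
    ← Real.rpow_mul (by positivity), Real.div_rpow hC.le hσ.le]
  have h : σ ^ (4 / 3 : ℝ) * σ ^ ((2 : ℕ) * (1 / 3) : ℝ) = σ ^ 2 := by
    rw [← Real.rpow_add hσ, ← Real.rpow_natCast σ 2]
    norm_num
  rw [← h]
  have : σ ^ ((2 : ℕ) * (1 / 3) : ℝ) ≠ 0 := (Real.rpow_pos_of_pos hσ _).ne'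
  field_simp
  norm_num

lemma lower_bound_cube_root {n : ℕ} {U C σ : ℝ} (hn : 3 < n) (hσ : 0 ≤ σ) (hU : σ ≤ U)
    (hC : 0 < C) (hσC : σ ≤ C)
    (x : Strategy n) (S : ENNReal) (hS : ∀ θ ∈ groundTruths n U C, risk σ x θ ≤ S) :
    ENNReal.ofReal (κ / 2 *
      ((n : ℝ) ^ (1 / 3 : ℝ) * C ^ (2 / 3 : ℝ) * σ ^ (4 / 3 : ℝ))) ≤ S := by
  have hn0 : (0 : ℝ) < n := by exact_mod_cast (by omega : 0 < n)
  have hn1 : (1 : ℝ) ≤ n := by exact_mod_cast (by omega : 1 ≤ n)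
  rcases hσ.eq_or_lt with rfl | hσ0
  · rw [Real.zero_rpow (by norm_num)]
    simp
  rw [rpow_third_mul_identity hn0 hC hσ0]
  set q := (n : ℝ) * (C / σ) ^ 2 with hq
  have hq0 : 0 < q := by positivity
  set a := q ^ (1 / 3 : ℝ) with ha
  have ha0 : 0 < a := Real.rpow_pos_of_pos hq0 _
  have ha3 : a ^ 3 = q := by
    rw [ha, ← Real.rpow_natCast, ← Real.rpow_mul hq0.le]
    norm_num
  have hq1 : 1 ≤ q := by
    have : 1 ≤ C / σ := (one_le_div hσ0).2 hσC
    exact one_le_mul_of_one_le_of_one_le hn1 (one_le_pow₀ this)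
  have haσ : a ^ 3 * σ ^ 2 = n * C ^ 2 := by
    rw [ha3, hq]
    field_simp
  rcases le_total a n with han | hna
  · exact lower_bound_blocks hσ hU hC.le (Real.one_le_rpow hq1 (by norm_num)) han haσ x S hS
  -- For `a ≥ n`, `nσ²a ≤ σ²a³ = nC²`, so the jump bound suffices.
  · refine le_trans (ENNReal.ofReal_le_ofReal ?_) (lower_bound_C hn hσ (hσ.trans hU) hC.le x S hS)
    have h1 : n * (σ ^ 2 * a) ≤ n * C ^ 2 :=
      calc n * (σ ^ 2 * a) ≤ a ^ 2 * (σ ^ 2 * a) := by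
            gcongr
            nlinarith
        _ = n * C ^ 2 := by rw [← haσ]; ring
    have h2 := mul_le_mul_of_nonneg_left (le_of_mul_le_mul_left h1 hn0) κ_pos.le
    nlinarith [κ_pos, mul_nonneg κ_pos.le (sq_nonneg C)]

end TVForecast

/-! ### Combination of the four bounds -/

open TVForecast in
theorem proposition2 :
    ∃ c : ℝ, 0 < c ∧
      ∀ (n : ℕ) (U C σ : ℝ), 3 < n → 0 ≤ σ → 2 * Real.pi * σ < min U C →
        ENNReal.ofReal
            (c * (U ^ 2 + C ^ 2 + σ ^ 2 * Real.log (n : ℝ)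
              + (n : ℝ) ^ (1 / 3 : ℝ) * C ^ (2 / 3 : ℝ) * σ ^ (4 / 3 : ℝ)))
          ≤ TVForecast.minimaxRisk n U C σ := by
  have hκ := κ_pos
  -- The bounds `2κ`, `2κ`, `κ/4`, `κ/2` have reciprocals summing to `7/κ`, so `κ/16` is small
  -- enough.
  refine ⟨κ / 16, by positivity, fun n U C σ hn hσ hmin => ?_⟩
  have hσπ : σ ≤ 2 * Real.pi * σ := le_mul_of_one_le_left hσ (by linarith [Real.two_le_pi])
  have hU : σ < U := hσπ.trans_lt (hmin.trans_le (min_le_left _ _))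
  have hC : σ < C := hσπ.trans_lt (hmin.trans_le (min_le_right _ _))
  refine le_iInf fun x => ?_
  set S := ⨆ θ ∈ groundTruths n U C, risk σ x θ
  have hS : ∀ θ ∈ groundTruths n U C, risk σ x θ ≤ S := fun θ hθ =>
    le_iSup₂ (f := fun θ (_ : θ ∈ groundTruths n U C) => risk σ x θ) θ hθ
  have b1 := lower_bound_U hn hσ (hσ.trans hU.le) (hσ.trans hC.le) x S hS
  have b2 := lower_bound_C hn hσ (hσ.trans hU.le) (hσ.trans hC.le) x S hS
  have b3 := lower_bound_log hn hσ hU.le (hσ.trans hC.le) x S hS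
  have b4 := lower_bound_cube_root hn hσ hU.le (hσ.trans_lt hC) hC.le x S hS
  set A := σ ^ 2 * Real.log n
  set B := (n : ℝ) ^ (1 / 3 : ℝ) * C ^ (2 / 3 : ℝ) * σ ^ (4 / 3 : ℝ)
  have p1 : 0 ≤ κ * U ^ 2 := by positivity
  have p2 : 0 ≤ κ * C ^ 2 := by positivity
  have p3 : 0 ≤ κ * A := mul_nonneg hκ.le (mul_nonneg (sq_nonneg σ) (Real.log_natCast_nonneg n))
  have p4 : 0 ≤ κ * B := by
    have : 0 ≤ C := hσ.trans hC.le
    positivity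
  by_contra hlt
  have l1 := (ENNReal.ofReal_lt_ofReal_iff').1 (b1.trans_lt (not_le.1 hlt))
  have l2 := (ENNReal.ofReal_lt_ofReal_iff').1 (b2.trans_lt (not_le.1 hlt))
  have l3 := (ENNReal.ofReal_lt_ofReal_iff').1 (b3.trans_lt (not_le.1 hlt))
  have l4 := (ENNReal.ofReal_lt_ofReal_iff').1 (b4.trans_lt (not_le.1 hlt))
  linarith [l1.1, l2.1, l3.1, l4.1]
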